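/- Let $\Gamma$ be a cycle with an odd number $n\ge 3$ of vertices, regarded as a metric graph all of whose edges have the same length $l>0$ (each edge $e$ is oriented and identified with the interval $[0,l_e]$, $l_e=l$). For a finite connected simple metric graph $G$ with edge lengths $l_e$, let $L^{a/st}(G)$ be the anti-standard Laplacian in the real Hilbert space $L^2(G)=\bigoplus_e L^2[0,l_e]$: it acts as $f\mapsto -f''$ on the functions $f$ with $f$ and $f'$ absolutely continuous on every edge and $f''\in L^2(G)$ such that at every vertex $v$ the derivatives of $f$ at $v$ along the edges incident to $v$, taken in the outgoing direction, all coincide, and the values of $f$ at $v$ along the edges incident to $v$ add up to $0$. Denote by $\lambda_1(L^{a/st}(G))\le\lambda_2(L^{a/st}(G))\le\cdots$ its eigenvalues, repeated according to multiplicity. Let $\mathcal A$ be the adjacency matrix of $\Gamma$, let $\mathcal Z=\mathrm{Diag}(\mathcal A e)^{-1}\mathcal A$ with $e=(1,\dots,1)^{\top}$ be its transition matrix, and let $\mu_1\ge\mu_2\ge\cdots\ge\mu_n$ be the eigenvalues of $\mathcal Z$, repeated according to multiplicity. Assume that $$\mu_i\le-\mu_{n+2-i}\quad(2\le i\le n),\qquad\qquad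 \mu_i\ge-\mu_{n-i}\quad(2\le i\le n-2).$$ Let $\widetilde\Gamma$ be a metric graph obtained from $\Gamma$ by inserting at least one new vertex into the interior of each edge (so that the edge is replaced by a path of the same total length), and assume that $\widetilde\Gamma$ is bipartite and that all its edges have the same length. Then the eigenvalues of $L^{a/st}(\Gamma)$ and of $L^{a/st}(\widetilde\Gamma)$, counted with their finite multiplicities, can be listed as infinite nondecreasing sequences $\lambda_1\le\lambda_2\le\cdots$, and $$\lambda_{k+1}(L^{a/st}(\widetilde\Gamma))\ \ge\ \lambda_k(L^{a/st}(\Gamma))\qquad\text{for all } k=1,2,3,\dots$$ -/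

import Mathlib

open MeasureTheory Set

noncomputable section

/-- A connected simple metric graph with vertex set `V` and edge set `E`.  Every edge `e` is
oriented from `src e` to `tgt e` and identified with the interval `[0, len e]`. -/
structure MetricGraph (V E : Type*) where
  src : E → V
  tgt : E → V
  len : E → ℝ
  len_pos : ∀ e, 0 < len e
  /-- there are no loops -/
  src_ne_tgt : ∀ e, src e ≠ tgt e
  /-- at most one edge joins two given vertices -/
  simple : Function.Injective fun e => s(src e, tgt e)
  connected : (SimpleGraph.fromEdgeSet (Set.range fun e => s(src e, tgt e))).Connected

namespace MetricGraph

variable {V E : Type*} (Γ : MetricGraph V E)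

/-! ### Combinatorial notions -/

/-- The underlying combinatorial graph. -/
def graph : SimpleGraph V := SimpleGraph.fromEdgeSet (Set.range fun e => s(Γ.src e, Γ.tgt e))

/-- All edges have the same length. -/
def IsEquilateral : Prop := ∀ e e', Γ.len e = Γ.len e'

/-- The underlying graph is a cycle with an odd number `n ≥ 3` of vertices. -/
def IsOddCycle : Prop :=
  ∃ n : ℕ, 3 ≤ n ∧ Odd n ∧ Nonempty (Γ.graph ≃g SimpleGraph.cycleGraph n)

open scoped Classical in
/-- The adjacency matrix `A` of the graph. -/
def adjacency [Fintype V] : Matrix V V ℝ := Γ.graph.adjMatrix ℝ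

open scoped Classical in
/-- The transition matrix `Z = Diag(A e)⁻¹ A`, where `e = (1, …, 1)`. -/
def transition [Fintype V] : Matrix V V ℝ :=
  (Matrix.diagonal (Γ.adjacency.mulVec 1))⁻¹ * Γ.adjacency

open scoped Classical in
/-- `μ 1 ≥ μ 2 ≥ ⋯ ≥ μ n` are the `n = |V|` eigenvalues of the transition matrix, listed with
their multiplicities (other values of `μ` are irrelevant). -/
def IsTransitionSpectrum [Fintype V] (μ : ℕ → ℝ) : Prop :=
  AntitoneOn μ (Set.Icc 1 (Fintype.card V)) ∧
    Γ.transition.charpoly.roots = (Finset.Icc 1 (Fintype.card V)).val.map μ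

/-! ### The Hilbert space and the Laplace operators -/

/-- The Hilbert space `L²(Γ) = ⨁ₑ L²[0, len e]`. -/
abbrev L2 [Fintype E] : Type _ :=
  PiLp 2 fun e : E => Lp ℝ 2 (volume.restrict (Icc 0 (Γ.len e)))

/-- `u` is a representative of `f ∈ L²(Γ)` such that on every edge `u` is differentiable on the
whole closed interval `[0, len e]` with derivative `u'`, and both `u` and `u'` are absolutely
continuous. -/
structure IsRegularRep [Fintype E] (f : Γ.L2) (u u' : E → ℝ → ℝ) : Prop where
  ae_eq : ∀ e, (f e : ℝ → ℝ) =ᵐ[volume.restrict (Icc 0 (Γ.len e))] u e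
  ac : ∀ e, AbsolutelyContinuousOnInterval (u e) 0 (Γ.len e)
  hasDeriv : ∀ e, ∀ x ∈ Icc 0 (Γ.len e), HasDerivWithinAt (u e) (u' e x) (Icc 0 (Γ.len e)) x
  ac_deriv : ∀ e, AbsolutelyContinuousOnInterval (u' e) 0 (Γ.len e)

variable {Γ} in
theorem IsRegularRep.add [Fintype E] {f g : Γ.L2} {u u' v v' : E → ℝ → ℝ}
    (hf : Γ.IsRegularRep f u u') (hg : Γ.IsRegularRep g v v') :
    Γ.IsRegularRep (f + g) (u + v) (u' + v') where
  ae_eq e := (Lp.coeFn_add (f e) (g e)).trans ((hf.ae_eq e).add (hg.ae_eq e))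
  ac e := (hf.ac e).add (hg.ac e)
  hasDeriv e x hx := (hf.hasDeriv e x hx).add (hg.hasDeriv e x hx)
  ac_deriv e := (hf.ac_deriv e).add (hg.ac_deriv e)

variable {Γ} in
theorem IsRegularRep.smul [Fintype E] {f : Γ.L2} {u u' : E → ℝ → ℝ} (c : ℝ)
    (hf : Γ.IsRegularRep f u u') : Γ.IsRegularRep (c • f) (c • u) (c • u') where
  ae_eq e := (Lp.coeFn_smul c (f e)).trans ((hf.ae_eq e).const_smul c)
  ac e := (hf.ac e).const_mul c
  hasDeriv e x hx := (hf.hasDeriv e x hx).const_mul c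
  ac_deriv e := (hf.ac_deriv e).const_mul c

theorem isRegularRep_zero [Fintype E] : Γ.IsRegularRep 0 0 0 where
  ae_eq e := Lp.coeFn_zero _ _ _
  ac e := (LipschitzOnWith.absolutelyContinuousOnInterval
    ((LipschitzWith.const (0 : ℝ)).lipschitzOnWith (s := uIcc 0 (Γ.len e))))
  hasDeriv e x _ := hasDerivWithinAt_const x _ (0 : ℝ)
  ac_deriv e := (LipschitzOnWith.absolutelyContinuousOnInterval
    ((LipschitzWith.const (0 : ℝ)).lipschitzOnWith (s := uIcc 0 (Γ.len e))))

variable {Γ} in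
/-- The regular representative and its derivative are unique on every edge. -/
theorem IsRegularRep.unique [Fintype E] {f : Γ.L2} {u u' v v' : E → ℝ → ℝ}
    (hu : Γ.IsRegularRep f u u') (hv : Γ.IsRegularRep f v v') (e : E) :
    EqOn (u e) (v e) (Icc 0 (Γ.len e)) ∧ EqOn (u' e) (v' e) (Icc 0 (Γ.len e)) := by
  have hpos := Γ.len_pos e
  have h1 : EqOn (u e) (v e) (Icc 0 (Γ.len e)) := by
    refine Measure.eqOn_Icc_of_ae_eq volume hpos.ne
      ((hu.ae_eq e).symm.trans (hv.ae_eq e)) ?_ ?_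
    · simpa [uIcc_of_le hpos.le] using (hu.ac e).continuousOn
    · simpa [uIcc_of_le hpos.le] using (hv.ac e).continuousOn
  refine ⟨h1, fun x hx => ?_⟩
  exact (uniqueDiffOn_Icc hpos x hx).eq_deriv _ (hu.hasDeriv e x hx)
    ((hv.hasDeriv e x hx).congr (fun y hy => h1 hy) (h1 hx))

/-- The graph of the maximal Laplace operator: all pairs `(f, -f'')` of elements of `L²(Γ)` such
that `f` and `f'` are absolutely continuous on every edge. -/
def maxGraph [Fintype E] : Submodule ℝ (Γ.L2 × Γ.L2) where
  carrier := {p | ∃ u u', Γ.IsRegularRep p.1 u u' ∧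
    ∀ e, (p.2 e : ℝ → ℝ) =ᵐ[volume.restrict (Icc 0 (Γ.len e))] fun x => -deriv (u' e) x}
  zero_mem' := ⟨0, 0, Γ.isRegularRep_zero, fun e => by
    filter_upwards [Lp.coeFn_zero ℝ 2 (volume.restrict (Icc 0 (Γ.len e)))] with x hx
    have h0 : deriv ((0 : E → ℝ → ℝ) e) x = 0 := by
      simp
    rw [h0, neg_zero]
    exact hx⟩
  add_mem' := by
    rintro p q ⟨u, u', hu, hp⟩ ⟨v, v', hv, hq⟩
    refine ⟨u + v, u' + v', hu.add hv, fun e => ?_⟩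
    have hle := (Γ.len_pos e).le
    have h1 := (ae_restrict_iff' measurableSet_Icc).2
      (by simpa [uIcc_of_le hle] using (hu.ac_deriv e).ae_differentiableAt)
    have h2 := (ae_restrict_iff' measurableSet_Icc).2
      (by simpa [uIcc_of_le hle] using (hv.ac_deriv e).ae_differentiableAt)
    filter_upwards [Lp.coeFn_add (p.2 e) (q.2 e), hp e, hq e, h1, h2] with x hx h3 h4 h5 h6
    have h7 : deriv ((u' + v') e) x = deriv (u' e) x + deriv (v' e) x := deriv_add h5 h6
    rw [h7, neg_add, ← h3, ← h4]
    exact hx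
  smul_mem' := by
    rintro c p ⟨u, u', hu, hp⟩
    refine ⟨c • u, c • u', hu.smul c, fun e => ?_⟩
    filter_upwards [Lp.coeFn_smul c (p.2 e), hp e] with x hx h3
    have h7 : deriv ((c • u') e) x = c * deriv (u' e) x := deriv_const_mul_field (v := u' e) c
    rw [h7, ← mul_neg, ← h3]
    exact hx

theorem maxGraph_single_valued [Fintype E] (p : Γ.L2 × Γ.L2) (hp : p ∈ Γ.maxGraph)
    (h0 : p.1 = 0) : p.2 = 0 := by
  obtain ⟨u, u', hu, hg⟩ := hp
  rw [h0] at hu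
  ext1 e
  have h := (hu.unique Γ.isRegularRep_zero e).2
  refine Lp.ext (((hg e).trans ?_).trans (Lp.coeFn_zero _ _ _).symm)
  rw [← Measure.restrict_congr_set (Ioo_ae_eq_Icc (μ := volume))]
  filter_upwards [ae_restrict_mem measurableSet_Ioo] with x hx
  have h1 : u' e =ᶠ[nhds x] fun _ => (0 : ℝ) := by
    filter_upwards [Icc_mem_nhds hx.1 hx.2] with y hy using h hy
  rw [h1.deriv_eq]
  simp

/-- The maximal Laplace operator `f ↦ -f''` on `L²(Γ)`. -/
def maxLaplacian [Fintype E] : Γ.L2 →ₗ.[ℝ] Γ.L2 := Γ.maxGraph.toLinearPMap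

theorem maxLaplacian_graph [Fintype E] : Γ.maxLaplacian.graph = Γ.maxGraph :=
  Submodule.toLinearPMap_graph_eq _ Γ.maxGraph_single_valued

/-- The vertex `w` is an end point of the edge `e`. -/
def Incident (w : V) (e : E) : Prop := Γ.src e = w ∨ Γ.tgt e = w

open scoped Classical in
/-- The value at the end point `w` of the edge `e` of a function `u` on the edges. -/
def endValue (u : E → ℝ → ℝ) (w : V) (e : E) : ℝ :=
  if Γ.src e = w then u e 0 else u e (Γ.len e)

open scoped Classical in
/-- The derivative at the end point `w`, along the edge `e` in the outgoing direction, of a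
function with edgewise derivative `u'`. -/
def outDeriv (u' : E → ℝ → ℝ) (w : V) (e : E) : ℝ :=
  if Γ.src e = w then u' e 0 else -u' e (Γ.len e)

open scoped Classical in
/-- The anti-standard (anti-Kirchhoff) vertex conditions: at every vertex all outgoing
derivatives agree and the values along the incident edges add up to zero. -/
structure AntiStandard [Fintype E] (u u' : E → ℝ → ℝ) : Prop where
  deriv_eq : ∀ w e e', Γ.Incident w e → Γ.Incident w e' →
    Γ.outDeriv u' w e = Γ.outDeriv u' w e'
  sum_eq_zero : ∀ w, ∑ e with Γ.Incident w e, Γ.endValue u w e = 0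

theorem endValue_add (u v : E → ℝ → ℝ) (w : V) (e : E) :
    Γ.endValue (u + v) w e = Γ.endValue u w e + Γ.endValue v w e := by
  unfold endValue; split_ifs <;> rfl

theorem endValue_smul (c : ℝ) (u : E → ℝ → ℝ) (w : V) (e : E) :
    Γ.endValue (c • u) w e = c * Γ.endValue u w e := by
  unfold endValue; split_ifs <;> rfl

theorem outDeriv_add (u v : E → ℝ → ℝ) (w : V) (e : E) :
    Γ.outDeriv (u + v) w e = Γ.outDeriv u w e + Γ.outDeriv v w e := by
  unfold outDeriv; split_ifs <;> simp [add_comm]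

theorem outDeriv_smul (c : ℝ) (u : E → ℝ → ℝ) (w : V) (e : E) :
    Γ.outDeriv (c • u) w e = c * Γ.outDeriv u w e := by
  unfold outDeriv; split_ifs <;> simp

/-- The elements of `L²(Γ)` whose regular representative satisfies the anti-standard vertex
conditions. -/
def antiStandardSpace [Fintype E] : Submodule ℝ Γ.L2 where
  carrier := {f | ∃ u u', Γ.IsRegularRep f u u' ∧ Γ.AntiStandard u u'}
  zero_mem' := ⟨0, 0, Γ.isRegularRep_zero, by simp [outDeriv], by simp [endValue]⟩
  add_mem' := by
    rintro f g ⟨u, u', hu, hu'⟩ ⟨v, v', hv, hv'⟩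
    refine ⟨u + v, u' + v', hu.add hv, ?_, ?_⟩
    · intro w e e' h h'
      rw [outDeriv_add, outDeriv_add, hu'.deriv_eq w e e' h h', hv'.deriv_eq w e e' h h']
    · intro w
      simp only [endValue_add, Finset.sum_add_distrib, hu'.sum_eq_zero w, hv'.sum_eq_zero w,
        add_zero]
  smul_mem' := by
    rintro c f ⟨u, u', hu, hu'⟩
    refine ⟨c • u, c • u', hu.smul c, ?_, ?_⟩
    · intro w e e' h h'
      rw [outDeriv_smul, outDeriv_smul, hu'.deriv_eq w e e' h h']
    · intro w
      simp only [endValue_smul, ← Finset.mul_sum, hu'.sum_eq_zero w, mul_zero]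

/-- The anti-standard Laplace operator: the restriction of the maximal Laplace operator to the
functions that satisfy the anti-standard vertex conditions. -/
def antiStandardLaplacian [Fintype E] : Γ.L2 →ₗ.[ℝ] Γ.L2 :=
  Γ.maxLaplacian.domRestrict Γ.antiStandardSpace

/-! ### Inserting vertices into the edges -/

/-- Data for inserting new vertices into the interior of every edge: on the edge `e` the
`num e ≥ 1` new vertices are placed at the points `pos e 1 < ⋯ < pos e (num e)` of the open
interval `(0, len e)`; by convention `pos e 0 = 0` and `pos e (num e + 1) = len e` (other values
of `pos e` are irrelevant). -/
structure Insertion where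
  num : E → ℕ
  num_pos : ∀ e, 1 ≤ num e
  pos : E → ℕ → ℝ
  pos_zero : ∀ e, pos e 0 = 0
  pos_last : ∀ e, pos e (num e + 1) = Γ.len e
  pos_lt : ∀ e, ∀ i ≤ num e, pos e i < pos e (i + 1)

variable {Γ} (S : Γ.Insertion)

/-- The vertex at the point `S.pos e j` of the edge `e`, for `0 ≤ j ≤ S.num e + 1`: an old vertex
for `j = 0` and `j = S.num e + 1`, and the `j`-th new vertex on `e` otherwise. -/
def Insertion.node (e : E) (j : ℕ) : V ⊕ (Σ e, Fin (S.num e)) :=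
  if j = 0 then Sum.inl (Γ.src e)
  else if h : j - 1 < S.num e then Sum.inr ⟨e, ⟨j - 1, h⟩⟩
  else Sum.inl (Γ.tgt e)

theorem Insertion.node_inner {e e' : E} {j j' : ℕ} (h1 : 1 ≤ j) (h2 : j ≤ S.num e)
    (h : S.node e j = S.node e' j') : e = e' ∧ j = j' := by
  have hj : j ≠ 0 := by omega
  have hlt : j - 1 < S.num e := by omega
  unfold node at h
  rw [if_neg hj, dif_pos hlt] at h
  split_ifs at h with h3 h4
  have h5 := Sum.inr_injective h
  obtain ⟨rfl, h6⟩ := Sigma.mk.inj_iff.1 h5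
  have h7 := congrArg Fin.val (eq_of_heq h6)
  simp only at h7
  exact ⟨rfl, by omega⟩

theorem Insertion.node_ne (e : E) (i : ℕ) (hi : i ≤ S.num e) : S.node e i ≠ S.node e (i + 1) := by
  intro h
  by_cases h0 : 1 ≤ i
  · have := (S.node_inner h0 hi h).2
    omega
  · have := (S.node_inner (j := i + 1) (by omega) (by have := S.num_pos e; omega) h.symm).2
    omega

/-- The metric graph obtained from `Γ` by inserting the new vertices: the edge `e` is replaced by
the path of the `S.num e + 1` edges `[S.pos e i, S.pos e (i + 1)]`. -/
def insertVertices : MetricGraph (V ⊕ (Σ e, Fin (S.num e))) (Σ e, Fin (S.num e + 1)) where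
  src a := S.node a.1 a.2
  tgt a := S.node a.1 (a.2 + 1)
  len a := S.pos a.1 (a.2 + 1) - S.pos a.1 a.2
  len_pos a := sub_pos.2 (S.pos_lt a.1 a.2 (by omega))
  src_ne_tgt a := S.node_ne a.1 a.2 (by omega)
  simple := by
    rintro ⟨e, i⟩ ⟨e', i'⟩ h
    have hn := S.num_pos e
    have hi := i.2
    simp only [Sym2.eq_iff] at h
    have key : e = e' ∧ (i : ℕ) = i' := by
      by_cases h0 : 1 ≤ (i : ℕ)
      · rcases h with ⟨h1, -⟩ | ⟨h1, h2⟩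
        · exact S.node_inner h0 (by omega) h1
        · obtain ⟨rfl, h3⟩ := S.node_inner h0 (by omega) h1
          by_cases h4 : 1 ≤ (i' : ℕ)
          · have := (S.node_inner h4 (by omega) h2.symm).2
            omega
          · have := (S.node_inner (j := i' + 1) (by omega) (by omega) h1.symm).2
            by_cases h5 : (i : ℕ) + 1 ≤ S.num e
            · have := (S.node_inner (by omega) h5 h2).2
              omega
            · exfalso
              have h6 : (i' : ℕ) = 0 := by omega
              unfold Insertion.node at h2
              rw [if_neg (by omega), dif_neg (by omega), if_pos h6] at h2
              exact Γ.src_ne_tgt e (Sum.inl_injective h2).symm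
      · rcases h with ⟨-, h2⟩ | ⟨h1, h2⟩
        · obtain ⟨h3, h4⟩ := S.node_inner (by omega) (by omega) h2
          exact ⟨h3, by omega⟩
        · obtain ⟨rfl, h3⟩ := S.node_inner (by omega) (by omega) h2
          by_cases h5 : (i' : ℕ) + 1 ≤ S.num e
          · have := (S.node_inner (by omega) h5 h1.symm).2
            omega
          · exfalso
            have h6 : (i : ℕ) = 0 := by omega
            unfold Insertion.node at h1
            rw [if_pos h6, if_neg (by omega), dif_neg (by omega)] at h1
            exact Γ.src_ne_tgt e (Sum.inl_injective h1)
    obtain ⟨rfl, h2⟩ := key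
    rw [Fin.ext h2]
  connected := by
    set G := SimpleGraph.fromEdgeSet (Set.range fun a : (Σ e, Fin (S.num e + 1)) =>
      s(S.node a.1 a.2, S.node a.1 (a.2 + 1))) with hG
    have step : ∀ e i, i ≤ S.num e → G.Adj (S.node e i) (S.node e (i + 1)) := fun e i hi => by
      rw [hG, SimpleGraph.fromEdgeSet_adj]
      exact ⟨⟨⟨e, ⟨i, by omega⟩⟩, rfl⟩, S.node_ne e i hi⟩
    have path : ∀ e i, i ≤ S.num e + 1 → G.Reachable (Sum.inl (Γ.src e)) (S.node e i) := by
      intro e i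
      induction i with
      | zero => intro _; simp [Insertion.node]
      | succ i ih => intro hi; exact (ih (by omega)).trans (step e i (by omega)).reachable
    have edge : ∀ e, G.Reachable (Sum.inl (Γ.src e)) (Sum.inl (Γ.tgt e)) := fun e => by
      simpa [Insertion.node] using path e (S.num e + 1) le_rfl
    have old : ∀ v w : V, G.Reachable (Sum.inl v) (Sum.inl w) := by
      intro v w
      obtain ⟨p⟩ := Γ.connected.preconnected v w
      induction p with
      | nil => rfl
      | cons h _ ih =>
        refine SimpleGraph.Reachable.trans ?_ ih
        rw [SimpleGraph.fromEdgeSet_adj] at h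
        obtain ⟨⟨e, he⟩, -⟩ := h
        rcases Sym2.eq_iff.1 he with ⟨rfl, rfl⟩ | ⟨rfl, rfl⟩
        · exact edge e
        · exact (edge e).symm
    have new : ∀ x, ∃ v : V, G.Reachable (Sum.inl v) x := by
      rintro (v | ⟨e, i⟩)
      · exact ⟨v, SimpleGraph.Reachable.refl _⟩
      · refine ⟨Γ.src e, ?_⟩
        have := path e (i + 1) (by omega)
        simpa [Insertion.node] using this
    have : Nonempty V := Γ.connected.nonempty
    refine (SimpleGraph.connected_iff _).2 ⟨fun x y => ?_, inferInstance⟩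
    obtain ⟨v, hv⟩ := new x
    obtain ⟨w, hw⟩ := new y
    exact hv.symm.trans ((old v w).trans hw)

end MetricGraph

/-! ### Eigenvalues -/

/-- The space of all `f` in the domain of `T` with `T f = c f`. -/
def eigenspaceOf {H : Type*} [AddCommGroup H] [Module ℝ H] (T : H →ₗ.[ℝ] H) (c : ℝ) :
    Submodule ℝ H :=
  T.graph.comap (LinearMap.id.prod (c • LinearMap.id))

theorem mem_eigenspaceOf {H : Type*} [AddCommGroup H] [Module ℝ H] (T : H →ₗ.[ℝ] H) (c : ℝ)
    (f : H) : f ∈ eigenspaceOf T c ↔ ∃ hf : f ∈ T.domain, T ⟨f, hf⟩ = c • f := by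
  simp [eigenspaceOf, LinearPMap.mem_graph_iff]

/-- `lam 0 ≤ lam 1 ≤ lam 2 ≤ ⋯` is the list of all eigenvalues of `T` in nondecreasing order, each
repeated according to its (finite) multiplicity.  The counting starts at `0`: the `k`-th
eigenvalue `λ_k(T)`, `k = 1, 2, …`, is `lam (k - 1)`. -/
structure IsEigenvalueList {H : Type*} [AddCommGroup H] [Module ℝ H] (T : H →ₗ.[ℝ] H)
    (lam : ℕ → ℝ) : Prop where
  mono : Monotone lam
  finite : ∀ c, FiniteDimensional ℝ (eigenspaceOf T c)
  card : ∀ c, {k | lam k = c}.encard = (Module.finrank ℝ (eigenspaceOf T c) : ℕ∞)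

end

/-!
At a vertex of degree two the anti-standard conditions say that, in passing through the vertex in a
fixed direction, both the value and the derivative change their sign. On a cycle with `N` edges and
total length `L`, the eigenvalue equation `-f'' = c f` therefore amounts to `y'' = -c y` on a circle
of length `L` with the holonomy `(-1)^N`, and the eigenspace is isomorphic to the space of all
Cauchy data `v` with `oscFlow c L v = (-1)^N v`
(`MetricGraph.CircularOrientation.finrank_eigenspaceOf`). The matrix `oscFlow c L` has determinant
`1` and trace `2 oscCos c L`, so these spaces are easily found. The eigenvalues are

* `(m π / L)²` with `m` odd, each of multiplicity two, for odd `N` (`isEigenvalueList_antiperiodic`);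
* `0`, and `(m π / L)²` with `m ≥ 2` even, each of multiplicity two, for even `N`
  (`isEigenvalueList_periodic`).

Inserting vertices does not change `L` and turns a cycle into a cycle, whose number of edges is even
when it is bipartite. The asserted inequality is then a comparison of two explicit sequences, since
a list of eigenvalues is determined by the operator (`IsEigenvalueList.unique`).

That a graph is a cycle is used in the form of a `MetricGraph.CircularOrientation`: a direction for
every edge such that one edge leaves and one edge enters every vertex. It passes easily to the
subdivided graph, and by connectedness the successor permutation of the edges is a single cycle.
-/

/-! ### The flow of the equation `y'' = -c y` -/

/-- The solution of `y'' = -c y` with `y 0 = 1` and `y' 0 = 0`, for an arbitrary real `c`. -/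
noncomputable def oscCos (c x : ℝ) : ℝ :=
  if 0 ≤ c then Real.cos (√c * x) else Real.cosh (√(-c) * x)

/-- The solution of `y'' = -c y` with `y 0 = 0` and `y' 0 = 1`, for an arbitrary real `c`. -/
noncomputable def oscSin (c x : ℝ) : ℝ :=
  if 0 < c then Real.sin (√c * x) / √c else if c = 0 then x else Real.sinh (√(-c) * x) / √(-c)

theorem oscCos_zero_right (c : ℝ) : oscCos c 0 = 1 := by
  unfold oscCos; split_ifs <;> simp

theorem oscSin_zero_right (c : ℝ) : oscSin c 0 = 0 := by
  unfold oscSin; split_ifs <;> simp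

theorem oscCos_neg (c x : ℝ) : oscCos c (-x) = oscCos c x := by
  unfold oscCos; split_ifs <;> simp

theorem oscSin_neg (c x : ℝ) : oscSin c (-x) = -oscSin c x := by
  unfold oscSin; split_ifs <;> simp [neg_div]

theorem hasDerivAt_oscCos (c x : ℝ) : HasDerivAt (oscCos c) (-(c * oscSin c x)) x := by
  have hmul (r : ℝ) : HasDerivAt (fun y : ℝ => r * y) r x := by
    simpa using (hasDerivAt_id x).const_mul r
  rcases lt_trichotomy c 0 with hc | rfl | hc
  · have h1 : oscCos c = fun y => Real.cosh (√(-c) * y) := by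
      funext y; rw [oscCos, if_neg (not_le.2 hc)]
    have hs : √(-c) ≠ 0 := (Real.sqrt_pos.2 (neg_pos.2 hc)).ne'
    rw [h1, oscSin, if_neg hc.le.not_gt, if_neg hc.ne]
    convert! (hmul √(-c)).cosh using 1
    have := Real.mul_self_sqrt (neg_pos.2 hc).le
    field_simp
    linear_combination -Real.sinh (√(-c) * x) * this
  · have h1 : oscCos 0 = fun _ => (1 : ℝ) := by
      funext y; simp [oscCos]
    rw [h1]
    simpa using hasDerivAt_const x (1 : ℝ)
  · have h1 : oscCos c = fun y => Real.cos (√c * y) := by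
      funext y; rw [oscCos, if_pos hc.le]
    have hs : √c ≠ 0 := (Real.sqrt_pos.2 hc).ne'
    rw [h1, oscSin, if_pos hc]
    convert! (hmul √c).cos using 1
    have := Real.mul_self_sqrt hc.le
    field_simp
    linear_combination Real.sin (√c * x) * this

theorem hasDerivAt_oscSin (c x : ℝ) : HasDerivAt (oscSin c) (oscCos c x) x := by
  have hmul (r : ℝ) : HasDerivAt (fun y : ℝ => r * y) r x := by
    simpa using (hasDerivAt_id x).const_mul r
  rcases lt_trichotomy c 0 with hc | rfl | hc
  · have h1 : oscSin c = fun y => Real.sinh (√(-c) * y) / √(-c) := by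
      funext y; rw [oscSin, if_neg hc.le.not_gt, if_neg hc.ne]
    have hs : √(-c) ≠ 0 := (Real.sqrt_pos.2 (neg_pos.2 hc)).ne'
    rw [h1, oscCos, if_neg (not_le.2 hc)]
    convert! (hmul √(-c)).sinh.div_const √(-c) using 1
    field_simp
  · have h1 : oscSin 0 = fun y => y := by
      funext y; simp [oscSin]
    rw [h1]
    simpa [oscCos] using hasDerivAt_id' x
  · have h1 : oscSin c = fun y => Real.sin (√c * y) / √c := by
      funext y; rw [oscSin, if_pos hc]
    have hs : √c ≠ 0 := (Real.sqrt_pos.2 hc).ne'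
    rw [h1, oscCos, if_pos hc.le]
    convert! (hmul √c).sin.div_const √c using 1
    field_simp

theorem oscCos_sq_add (c x : ℝ) : oscCos c x ^ 2 + c * oscSin c x ^ 2 = 1 := by
  have h (y : ℝ) : HasDerivAt (fun y => oscCos c y ^ 2 + c * oscSin c y ^ 2) 0 y := by
    convert! ((hasDerivAt_oscCos c y).pow 2).add
      (((hasDerivAt_oscSin c y).pow 2).const_mul c) using 1
    push_cast
    ring
  have := is_const_of_deriv_eq_zero (fun y => (h y).differentiableAt) (fun y => (h y).deriv) x 0
  simpa [oscCos_zero_right, oscSin_zero_right] using this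

/-- The linear map sending the Cauchy data `(y 0, y' 0)` of a solution of `y'' = -c y` to its
Cauchy data `(y x, y' x)`. -/
noncomputable def oscFlow (c x : ℝ) : ℝ × ℝ →ₗ[ℝ] ℝ × ℝ :=
  (oscCos c x • LinearMap.fst ℝ ℝ ℝ + oscSin c x • LinearMap.snd ℝ ℝ ℝ).prod
    (-(c * oscSin c x) • LinearMap.fst ℝ ℝ ℝ + oscCos c x • LinearMap.snd ℝ ℝ ℝ)

theorem oscFlow_fst (c x : ℝ) (v : ℝ × ℝ) :
    (oscFlow c x v).1 = oscCos c x * v.1 + oscSin c x * v.2 := by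
  simp [oscFlow]

theorem oscFlow_snd (c x : ℝ) (v : ℝ × ℝ) :
    (oscFlow c x v).2 = -(c * oscSin c x) * v.1 + oscCos c x * v.2 := by
  simp [oscFlow]

theorem oscFlow_zero (c : ℝ) (v : ℝ × ℝ) : oscFlow c 0 v = v := by
  ext <;> simp [oscFlow_fst, oscFlow_snd, oscCos_zero_right, oscSin_zero_right]

theorem hasDerivAt_oscFlow_fst (c x : ℝ) (v : ℝ × ℝ) :
    HasDerivAt (fun y => (oscFlow c y v).1) (oscFlow c x v).2 x := by
  simp only [oscFlow_fst, oscFlow_snd]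
  exact ((hasDerivAt_oscCos c x).mul_const _).add ((hasDerivAt_oscSin c x).mul_const _)

theorem hasDerivAt_oscFlow_snd (c x : ℝ) (v : ℝ × ℝ) :
    HasDerivAt (fun y => (oscFlow c y v).2) (-(c * (oscFlow c x v).1)) x := by
  simp only [oscFlow_fst, oscFlow_snd]
  convert! ((((hasDerivAt_oscSin c x).const_mul c).neg).mul_const v.1).add
    ((hasDerivAt_oscCos c x).mul_const v.2) using 1
  ring

theorem contDiff_oscFlow_snd (c : ℝ) (v : ℝ × ℝ) : ContDiff ℝ 1 fun y => (oscFlow c y v).2 := by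
  refine contDiff_one_iff_deriv.2
    ⟨fun x => (hasDerivAt_oscFlow_snd c x v).differentiableAt, ?_⟩
  rw [show deriv (fun y => (oscFlow c y v).2) = fun x => -(c * (oscFlow c x v).1) from
    funext fun x => (hasDerivAt_oscFlow_snd c x v).deriv]
  exact continuous_iff_continuousAt.2 fun x =>
    ((hasDerivAt_oscFlow_fst c x v).const_mul c).neg.continuousAt

theorem contDiff_oscFlow_fst (c : ℝ) (v : ℝ × ℝ) : ContDiff ℝ 1 fun y => (oscFlow c y v).1 := by
  refine contDiff_one_iff_deriv.2
    ⟨fun x => (hasDerivAt_oscFlow_fst c x v).differentiableAt, ?_⟩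
  rw [show deriv (fun y => (oscFlow c y v).1) = fun x => (oscFlow c x v).2 from
    funext fun x => (hasDerivAt_oscFlow_fst c x v).deriv]
  exact (contDiff_oscFlow_snd c v).continuous

theorem absolutelyContinuousOnInterval_oscCos (c a b : ℝ) :
    AbsolutelyContinuousOnInterval (oscCos c) a b := by
  simpa [oscFlow_fst] using
    (contDiff_oscFlow_fst c (1, 0)).contDiffOn.absolutelyContinuousOnInterval (a := a) (b := b)

theorem absolutelyContinuousOnInterval_oscSin (c a b : ℝ) :
    AbsolutelyContinuousOnInterval (oscSin c) a b := by
  simpa [oscFlow_fst] using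
    (contDiff_oscFlow_fst c (0, 1)).contDiffOn.absolutelyContinuousOnInterval (a := a) (b := b)

/-- Uniqueness for `y'' = -c y` in the Carathéodory sense: the equation is only assumed almost
everywhere, for an absolutely continuous `u'`. The backward flow carries `(u x, u' x)` to a pair of
absolutely continuous functions whose derivatives vanish almost everywhere. -/
theorem eq_oscFlow_of_ae {c l : ℝ} (hl : 0 ≤ l) {u u' : ℝ → ℝ}
    (hu : AbsolutelyContinuousOnInterval u 0 l) (hu' : AbsolutelyContinuousOnInterval u' 0 l)
    (h1 : ∀ᵐ x, x ∈ Icc 0 l → HasDerivAt u (u' x) x)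
    (h2 : ∀ᵐ x, x ∈ Icc 0 l → HasDerivAt u' (-(c * u x)) x) :
    ∀ x ∈ Icc 0 l, (u x, u' x) = oscFlow c x (u 0, u' 0) := by
  have hC := absolutelyContinuousOnInterval_oscCos c 0 l
  have hS := absolutelyContinuousOnInterval_oscSin c 0 l
  obtain ⟨A, hA⟩ := ((hC.mul hu).sub (hS.mul hu')).const_of_ae_hasDerivAt_zero (by
    filter_upwards [h1, h2] with x hx1 hx2 hx
    rw [uIcc_of_le hl] at hx
    convert! ((hasDerivAt_oscCos c x).mul (hx1 hx)).sub
      ((hasDerivAt_oscSin c x).mul (hx2 hx)) using 1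
    ring)
  obtain ⟨B, hB⟩ := (((hS.mul hu).const_mul c).add
      (hC.mul hu')).const_of_ae_hasDerivAt_zero (by
    filter_upwards [h1, h2] with x hx1 hx2 hx
    rw [uIcc_of_le hl] at hx
    convert! (((hasDerivAt_oscSin c x).mul (hx1 hx)).const_mul c).add
      ((hasDerivAt_oscCos c x).mul (hx2 hx)) using 1
    ring)
  rw [uIcc_of_le hl] at hA hB
  have hA0 := hA 0 ⟨le_rfl, hl⟩
  have hB0 := hB 0 ⟨le_rfl, hl⟩
  simp only [Pi.sub_apply, Pi.mul_apply, Pi.add_apply, oscCos_zero_right,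
    oscSin_zero_right] at hA hB hA0 hB0
  intro x hx
  have hAx := hA x hx
  have hBx := hB x hx
  have hsq := oscCos_sq_add c x
  have e1 : u 0 = A := by linarith
  have e2 : u' 0 = B := by linarith
  ext
  · simp only [oscFlow_fst, e1, e2, ← hAx, ← hBx]
    linear_combination -u x * hsq
  · simp only [oscFlow_snd, e1, e2, ← hAx, ← hBx]
    linear_combination -u' x * hsq

theorem oscFlow_add (c x y : ℝ) (v : ℝ × ℝ) :
    oscFlow c (x + y) v = oscFlow c x (oscFlow c y v) := by
  have hC : oscCos c (x + y) = oscCos c x * oscCos c y - c * oscSin c x * oscSin c y := by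
    rcases lt_trichotomy c 0 with hc | rfl | hc
    · have hs : √(-c) ≠ 0 := (Real.sqrt_pos.2 (neg_pos.2 hc)).ne'
      simp only [oscCos, oscSin, if_neg (not_le.2 hc), if_neg hc.le.not_gt, if_neg hc.ne, mul_add,
        Real.cosh_add]
      field_simp
      rw [Real.sq_sqrt (neg_pos.2 hc).le]
      ring
    · simp [oscCos]
    · have hs : √c ≠ 0 := (Real.sqrt_pos.2 hc).ne'
      simp only [oscCos, oscSin, if_pos hc, if_pos hc.le, mul_add, Real.cos_add]
      field_simp
      rw [Real.sq_sqrt hc.le]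
      ring
  have hS : oscSin c (x + y) = oscSin c x * oscCos c y + oscCos c x * oscSin c y := by
    rcases lt_trichotomy c 0 with hc | rfl | hc
    · have hs : √(-c) ≠ 0 := (Real.sqrt_pos.2 (neg_pos.2 hc)).ne'
      simp only [oscCos, oscSin, if_neg (not_le.2 hc), if_neg hc.le.not_gt, if_neg hc.ne, mul_add,
        Real.sinh_add]
      field_simp
    · simp [oscCos, oscSin]
    · have hs : √c ≠ 0 := (Real.sqrt_pos.2 hc).ne'
      simp only [oscCos, oscSin, if_pos hc, if_pos hc.le, mul_add, Real.sin_add]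
      field_simp
  ext <;> simp only [oscFlow_fst, oscFlow_snd, hC, hS] <;> ring

/-- Time reversal for the flow of `y'' = -c y`. -/
theorem oscFlow_neg (c x : ℝ) (v : ℝ × ℝ) :
    oscFlow c (-x) (v.1, -v.2) = ((oscFlow c x v).1, -(oscFlow c x v).2) := by
  ext <;> simp only [oscFlow_fst, oscFlow_snd, oscCos_neg, oscSin_neg] <;> ring

/-- The Cauchy data of the solutions of `y'' = -c y` with `y (x + L) = σ y x`. -/
noncomputable def monodromyKer (c L σ : ℝ) : Submodule ℝ (ℝ × ℝ) :=
  LinearMap.ker (oscFlow c L - σ • LinearMap.id)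

theorem mem_monodromyKer {c L σ : ℝ} {v : ℝ × ℝ} :
    v ∈ monodromyKer c L σ ↔ oscFlow c L v = σ • v := by
  simp [monodromyKer, sub_eq_zero]

/-- The determinant of `oscFlow c L - σ` is `2 - 2 σ oscCos c L`. -/
theorem monodromyKer_eq_bot {c L σ : ℝ} (hσ : σ ^ 2 = 1) (h : oscCos c L ≠ σ) :
    monodromyKer c L σ = ⊥ := by
  refine (Submodule.eq_bot_iff _).2 fun v hv => ?_
  rw [mem_monodromyKer] at hv
  have e1 := congrArg Prod.fst hv
  have e2 := congrArg Prod.snd hv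
  simp only [oscFlow_fst, oscFlow_snd, Prod.smul_fst, Prod.smul_snd, smul_eq_mul] at e1 e2
  have hsq := oscCos_sq_add c L
  have hd : 2 * σ * (σ - oscCos c L) ≠ 0 := by
    refine mul_ne_zero (mul_ne_zero two_ne_zero ?_) (sub_ne_zero.2 h.symm)
    rintro rfl
    norm_num at hσ
  ext
  · refine (mul_eq_zero.1 ?_).resolve_left hd
    linear_combination (oscCos c L - σ) * e1 - oscSin c L * e2 - v.1 * hsq + v.1 * hσ
  · refine (mul_eq_zero.1 ?_).resolve_left hd
    linear_combination (oscCos c L - σ) * e2 + c * oscSin c L * e1 - v.2 * hsq + v.2 * hσ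

theorem finrank_monodromyKer_of_ne {c L σ : ℝ} (hσ : σ ^ 2 = 1) (h : oscCos c L ≠ σ) :
    Module.finrank ℝ (monodromyKer c L σ) = 0 := by
  rw [monodromyKer_eq_bot hσ h, finrank_bot]

theorem finrank_monodromyKer_of_eq {c L σ : ℝ} (hc : c ≠ 0) (hσ : σ ^ 2 = 1)
    (h : oscCos c L = σ) : Module.finrank ℝ (monodromyKer c L σ) = 2 := by
  have hS : oscSin c L = 0 := by
    have hsq := oscCos_sq_add c L
    rw [h, hσ] at hsq
    have : c * oscSin c L ^ 2 = 0 := by linarith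
    simpa [hc] using this
  have : monodromyKer c L σ = ⊤ := by
    refine (Submodule.eq_top_iff').2 fun v => mem_monodromyKer.2 ?_
    ext <;> simp [oscFlow_fst, oscFlow_snd, h, hS]
  rw [this, finrank_top]
  simp

theorem finrank_monodromyKer_zero {L : ℝ} (hL : L ≠ 0) :
    Module.finrank ℝ (monodromyKer 0 L 1) = 1 := by
  have : monodromyKer 0 L 1 = LinearMap.range (LinearMap.inl ℝ ℝ ℝ) := by
    ext ⟨a, b⟩
    rw [mem_monodromyKer, Prod.ext_iff]
    simp [oscFlow_fst, oscFlow_snd, oscCos, oscSin, hL, eq_comm]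
  rw [this, LinearMap.finrank_range_of_inj LinearMap.inl_injective]
  simp

/-- For negative `c` the trace of the flow exceeds `2`. -/
theorem oscCos_gt_one_of_neg {c L : ℝ} (hc : c < 0) (hL : L ≠ 0) : 1 < oscCos c L := by
  rw [oscCos, if_neg (not_le.2 hc)]
  exact Real.one_lt_cosh.2 (mul_ne_zero (Real.sqrt_pos.2 (neg_pos.2 hc)).ne' hL)

/-! ### Lists of eigenvalues, and the spectra of a circle -/

/-- Were `lam' k < lam k`, the value `lam' k` would occur in `lam` only among the first `k` terms,
where the lists agree, and hence less often than in `lam'`. -/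
theorem IsEigenvalueList.unique_le {H : Type*} [AddCommGroup H] [Module ℝ H] {T : H →ₗ.[ℝ] H}
    {lam lam' : ℕ → ℝ} (h : IsEigenvalueList T lam) (h' : IsEigenvalueList T lam') {k : ℕ}
    (ih : ∀ j < k, lam j = lam' j) : lam k ≤ lam' k := by
  by_contra! hlt
  have hsub : {j | lam j = lam' k} ⊂ {j | lam' j = lam' k} := by
    refine ⟨fun j hj => ?_, fun hs => hlt.ne' (hs rfl)⟩
    have hjk : j < k := by
      by_contra! hkj
      exact absurd (h.mono hkj) (by rw [show lam j = lam' k from hj]; exact hlt.not_ge)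
    exact (ih j hjk).symm.trans hj
  have hfin : {j | lam j = lam' k}.Finite := by
    rw [← Set.encard_ne_top_iff, h.card]
    exact ENat.natCast_ne_top _
  have := hfin.encard_lt_encard hsub
  rw [h.card, h'.card] at this
  exact lt_irrefl _ this

theorem IsEigenvalueList.unique {H : Type*} [AddCommGroup H] [Module ℝ H] {T : H →ₗ.[ℝ] H}
    {lam lam' : ℕ → ℝ} (h : IsEigenvalueList T lam) (h' : IsEigenvalueList T lam') :
    lam = lam' := by
  funext k
  induction k using Nat.strong_induction_on with
  | _ k ih => exact le_antisymm (h.unique_le h' ih) (h'.unique_le h fun j hj => (ih j hj).symm)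

/-- The numbers `(m π / L)²` are the eigenvalues of `-y''` on a circle of length `L`, with periodic
boundary conditions for `m` even and antiperiodic ones for `m` odd. -/
theorem sq_pi_div_injective {L : ℝ} (hL : 0 < L) :
    Function.Injective fun m : ℕ => ((m : ℝ) * Real.pi / L) ^ 2 := by
  intro m m' h
  have h1 := (pow_left_inj₀ (by positivity) (by positivity) two_ne_zero).1 h
  have h2 := mul_right_cancel₀ Real.pi_ne_zero ((div_left_inj' hL.ne').1 h1)
  exact_mod_cast h2

theorem oscCos_sq_pi_div {L : ℝ} (hL : 0 < L) (m : ℕ) :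
    oscCos (((m : ℝ) * Real.pi / L) ^ 2) L = (-1) ^ m := by
  rw [oscCos, if_pos (sq_nonneg _), Real.sqrt_sq (by positivity), div_mul_cancel₀ _ hL.ne',
    Real.cos_nat_mul_pi]

theorem exists_eq_sq_pi_div {c L : ℝ} (hL : 0 < L) (h : oscCos c L ^ 2 = 1) :
    ∃ m : ℕ, c = ((m : ℝ) * Real.pi / L) ^ 2 := by
  rcases lt_or_ge c 0 with hc | hc
  · nlinarith [oscCos_gt_one_of_neg hc hL.ne']
  rw [oscCos, if_pos hc, ← Real.sin_sq_add_cos_sq (√c * L)] at h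
  have hs : Real.sin (√c * L) = 0 := by
    rw [← sq_eq_zero_iff]; linarith
  obtain ⟨n, hn⟩ := Real.sin_eq_zero_iff.1 hs
  have hn0 : 0 ≤ n := by
    by_contra! hneg
    have h1 : (n : ℝ) < 0 := by exact_mod_cast hneg
    have h2 : 0 ≤ √c * L := by positivity
    nlinarith [Real.pi_pos]
  obtain ⟨m, rfl⟩ := Int.eq_ofNat_of_zero_le hn0
  refine ⟨m, ?_⟩
  have : (m : ℝ) * Real.pi / L = √c := by
    rw [div_eq_iff hL.ne']
    exact_mod_cast hn
  rw [this, Real.sq_sqrt hc]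

/-- The eigenvalues of `-y''` with antiperiodic boundary conditions on a circle of length `L`. -/
noncomputable def antiperiodicEigenvalue (L : ℝ) (k : ℕ) : ℝ :=
  (((2 * (k / 2) + 1 : ℕ) : ℝ) * Real.pi / L) ^ 2

/-- The eigenvalues of `-y''` with periodic boundary conditions on a circle of length `L`. -/
noncomputable def periodicEigenvalue (L : ℝ) (k : ℕ) : ℝ :=
  (((2 * ((k + 1) / 2) : ℕ) : ℝ) * Real.pi / L) ^ 2

theorem antiperiodicEigenvalue_le_periodicEigenvalue {L : ℝ} (hL : 0 < L) (k : ℕ) :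
    antiperiodicEigenvalue L k ≤ periodicEigenvalue L (k + 1) := by
  unfold antiperiodicEigenvalue periodicEigenvalue
  have := Real.pi_pos
  have : 2 * (k / 2) + 1 ≤ 2 * ((k + 1 + 1) / 2) := by omega
  gcongr

theorem isEigenvalueList_antiperiodic {H : Type*} [AddCommGroup H] [Module ℝ H] {T : H →ₗ.[ℝ] H}
    {L : ℝ} (hL : 0 < L) (hfin : ∀ c, FiniteDimensional ℝ (eigenspaceOf T c))
    (hT : ∀ c, Module.finrank ℝ (eigenspaceOf T c) = Module.finrank ℝ (monodromyKer c L (-1))) :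
    IsEigenvalueList T (antiperiodicEigenvalue L) where
  mono j k hjk := by
    unfold antiperiodicEigenvalue
    have := Real.pi_pos
    gcongr
  finite := hfin
  card c := by
    rw [hT]
    by_cases h : oscCos c L = -1
    · obtain ⟨m, rfl⟩ := exists_eq_sq_pi_div hL (by rw [h]; norm_num : oscCos c L ^ 2 = 1)
      rw [oscCos_sq_pi_div hL] at h
      have hm : Odd m := by
        by_contra hm
        rw [(Nat.not_odd_iff_even.1 hm).neg_one_pow] at h
        norm_num at h
      have hc : (((m : ℝ) * Real.pi / L) ^ 2) ≠ 0 := by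
        have : 0 < m := hm.pos
        have := Real.pi_pos
        positivity
      rw [finrank_monodromyKer_of_eq hc (by norm_num)
        (by rw [oscCos_sq_pi_div hL, hm.neg_one_pow])]
      have : {k | antiperiodicEigenvalue L k = ((m : ℝ) * Real.pi / L) ^ 2} = {m - 1, m} := by
        ext k
        obtain ⟨r, rfl⟩ := hm
        refine (sq_pi_div_injective hL).eq_iff.trans ?_
        simp only [mem_insert_iff, mem_singleton_iff]
        omega
      rw [this, Set.encard_pair (by have := hm.pos; omega)]
      rfl
    · rw [finrank_monodromyKer_of_ne (by norm_num) h]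
      have : {k | antiperiodicEigenvalue L k = c} = ∅ := by
        refine Set.eq_empty_of_forall_notMem fun k hk => h ?_
        rw [← show antiperiodicEigenvalue L k = c from hk]
        exact (oscCos_sq_pi_div hL _).trans (Odd.neg_one_pow ⟨k / 2, rfl⟩)
      simp [this]

theorem isEigenvalueList_periodic {H : Type*} [AddCommGroup H] [Module ℝ H] {T : H →ₗ.[ℝ] H}
    {L : ℝ} (hL : 0 < L) (hfin : ∀ c, FiniteDimensional ℝ (eigenspaceOf T c))
    (hT : ∀ c, Module.finrank ℝ (eigenspaceOf T c) = Module.finrank ℝ (monodromyKer c L 1)) :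
    IsEigenvalueList T (periodicEigenvalue L) where
  mono j k hjk := by
    unfold periodicEigenvalue
    have := Real.pi_pos
    gcongr
  finite := hfin
  card c := by
    rw [hT]
    by_cases h : oscCos c L = 1
    · obtain ⟨m, rfl⟩ := exists_eq_sq_pi_div hL (by rw [h]; norm_num : oscCos c L ^ 2 = 1)
      rw [oscCos_sq_pi_div hL] at h
      have hm : Even m := by
        by_contra hm
        rw [(Nat.not_even_iff_odd.1 hm).neg_one_pow] at h
        norm_num at h
      have hset : {k | periodicEigenvalue L k = ((m : ℝ) * Real.pi / L) ^ 2} = {m - 1, m} := by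
        ext k
        obtain ⟨r, rfl⟩ := hm
        refine (sq_pi_div_injective hL).eq_iff.trans ?_
        simp only [mem_insert_iff, mem_singleton_iff]
        omega
      -- For `m = 0` the subtraction truncates, and the set is a singleton.
      rw [hset]
      rcases Nat.eq_zero_or_pos m with rfl | hpos
      · rw [show (((0 : ℕ) : ℝ) * Real.pi / L) ^ 2 = 0 by simp, finrank_monodromyKer_zero hL.ne']
        simp
      · have hc : (((m : ℝ) * Real.pi / L) ^ 2) ≠ 0 := by
          have := Real.pi_pos
          positivity
        rw [finrank_monodromyKer_of_eq hc (by norm_num)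
          (by rw [oscCos_sq_pi_div hL, hm.neg_one_pow]), Set.encard_pair (by omega)]
        rfl
    · rw [finrank_monodromyKer_of_ne (by norm_num) h]
      have : {k | periodicEigenvalue L k = c} = ∅ := by
        refine Set.eq_empty_of_forall_notMem fun k hk => h ?_
        rw [← show periodicEigenvalue L k = c from hk]
        exact (oscCos_sq_pi_div hL _).trans (even_two_mul _).neg_one_pow
      simp [this]

namespace MetricGraph

variable {V E : Type*}

/-! ### Circular orientations -/

/-- A choice of a direction on every edge, from `first e` to `second e`, such that exactly one edge
leaves and exactly one edge enters every vertex. It need not agree with the orientation that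
parametrises the edges. -/
structure CircularOrientation (Γ : MetricGraph V E) where
  first : E → V
  second : E → V
  ends : ∀ e, (first e = Γ.src e ∧ second e = Γ.tgt e) ∨ (first e = Γ.tgt e ∧ second e = Γ.src e)
  first_bijective : Function.Bijective first
  second_bijective : Function.Bijective second

namespace CircularOrientation

variable {Γ : MetricGraph V E} (O : Γ.CircularOrientation)

theorem first_ne_second (e : E) : O.first e ≠ O.second e := by
  rcases O.ends e with ⟨h1, h2⟩ | ⟨h1, h2⟩ <;> rw [h1, h2]
  · exact Γ.src_ne_tgt e
  · exact (Γ.src_ne_tgt e).symm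

theorem second_eq (e : E) (h : O.first e = Γ.src e) : O.second e = Γ.tgt e := by
  rcases O.ends e with ⟨-, h2⟩ | ⟨h1, -⟩
  · exact h2
  · exact absurd (h.symm.trans h1) (Γ.src_ne_tgt e)

theorem eq_of_first_ne (e : E) (h : O.first e ≠ Γ.src e) :
    O.first e = Γ.tgt e ∧ O.second e = Γ.src e :=
  (O.ends e).resolve_left fun h' => h h'.1

theorem mk_first_second (e : E) : s(O.first e, O.second e) = s(Γ.src e, Γ.tgt e) := by
  rcases O.ends e with ⟨h1, h2⟩ | ⟨h1, h2⟩ <;> rw [h1, h2]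
  exact Sym2.eq_swap

theorem incident_iff {w : V} {e : E} : Γ.Incident w e ↔ O.first e = w ∨ O.second e = w := by
  unfold Incident
  rcases O.ends e with ⟨h1, h2⟩ | ⟨h1, h2⟩ <;> rw [h1, h2]
  exact or_comm

/-- All directions reversed. -/
def reverse : Γ.CircularOrientation where
  first := O.second
  second := O.first
  ends e := (O.ends e).symm.imp And.symm And.symm
  first_bijective := O.second_bijective
  second_bijective := O.first_bijective

/-- The edge that leaves the vertex entered by a given edge. -/
noncomputable def next : Equiv.Perm E :=
  (Equiv.ofBijective _ O.second_bijective).trans (Equiv.ofBijective _ O.first_bijective).symm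

theorem first_next (e : E) : O.first (O.next e) = O.second e :=
  Equiv.ofBijective_apply_symm_apply O.first O.first_bijective (O.second e)

theorem incident_second_iff {e e' : E} :
    Γ.Incident (O.second e) e' ↔ e' = e ∨ e' = O.next e := by
  rw [O.incident_iff, or_comm, ← O.first_next e, O.first_bijective.1.eq_iff, O.first_next,
    O.second_bijective.1.eq_iff]

theorem next_ne (e : E) : O.next e ≠ e := fun h => O.first_ne_second e <| by
  rw [← O.first_next, h]

theorem card_eq (O : Γ.CircularOrientation) [Fintype V] [Fintype E] :
    Fintype.card E = Fintype.card V :=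
  Fintype.card_of_bijective O.first_bijective

/-- As the graph is connected, following the directions visits all edges. -/
theorem isCycleOn_next : O.next.IsCycleOn univ := by
  refine ⟨bijOn_univ.2 O.next.bijective, fun e _ e' _ => ?_⟩
  have key : ∀ {v w : V}, (SimpleGraph.fromEdgeSet
      (Set.range fun e => s(Γ.src e, Γ.tgt e))).Walk v w →
      ∀ a b, O.first a = v → O.first b = w → O.next.SameCycle a b := by
    intro v w p
    induction p with
    | nil =>
      rintro a b rfl h
      rw [O.first_bijective.1 h]
    | cons h _ ih =>
      intro a b ha hb
      rw [SimpleGraph.fromEdgeSet_adj] at h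
      obtain ⟨⟨x, hx⟩, -⟩ := h
      replace hx := (O.mk_first_second x).trans hx
      rcases Sym2.eq_iff.1 hx with ⟨h1, h2⟩ | ⟨h1, h2⟩
      · rw [O.first_bijective.1 (ha.trans h1.symm)]
        exact Equiv.Perm.sameCycle_apply_left.1 (ih (O.next x) b (by rw [O.first_next, h2]) hb)
      · rw [O.first_bijective.1 (ha.trans (h2.symm.trans (O.first_next x).symm))]
        exact Equiv.Perm.sameCycle_apply_left.2 (ih x b h1 hb)
  obtain ⟨p⟩ := Γ.connected.preconnected (O.first e) (O.first e')
  exact key p e e' rfl rfl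

theorem isCycleOn_next_univ [Fintype E] : O.next.IsCycleOn (Finset.univ : Finset E) := by
  rw [Finset.coe_univ]
  exact O.isCycleOn_next

theorem exists_pow_next_eq [Fintype E] (e e' : E) :
    ∃ i < Fintype.card E, (O.next ^ i) e = e' := by
  simpa using O.isCycleOn_next_univ.exists_pow_eq (Finset.mem_univ e) (Finset.mem_univ e')

theorem pow_card_next [Fintype E] (e : E) : (O.next ^ Fintype.card E) e = e := by
  simpa using O.isCycleOn_next_univ.pow_card_apply (Finset.mem_univ e)

theorem pow_next_injOn [Fintype E] (e : E) {i j : ℕ} (hi : i < Fintype.card E)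
    (hj : j < Fintype.card E) (h : (O.next ^ i) e = (O.next ^ j) e) : i = j := by
  rw [O.isCycleOn_next_univ.pow_apply_eq_pow_apply (Finset.mem_univ e), Finset.card_univ] at h
  exact Nat.ModEq.eq_of_lt_of_lt h hi hj

theorem nonempty_edge (O : Γ.CircularOrientation) : Nonempty E := by
  have := Γ.connected.nonempty
  obtain ⟨e, -⟩ := O.first_bijective.2 (Classical.arbitrary V)
  exact ⟨e⟩

/-- A proper `2`-colouring alternates along the directed edges. -/
theorem even_card_of_isBipartite (O : Γ.CircularOrientation) [Fintype E]
    (h : Γ.graph.IsBipartite) :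
    Even (Fintype.card E) := by
  obtain ⟨col⟩ := h
  have hstep (e : E) : col (O.first (O.next e)) = col (O.first e) + 1 := by
    have hadj : Γ.graph.Adj (O.first e) (O.first (O.next e)) := by
      rw [graph, SimpleGraph.fromEdgeSet_adj, O.first_next]
      exact ⟨⟨e, (O.mk_first_second e).symm⟩, O.first_ne_second e⟩
    have := col.valid hadj
    generalize col (O.first e) = a at this
    generalize col (O.first (O.next e)) = b at this
    fin_cases a <;> fin_cases b <;> simp_all
  obtain ⟨e⟩ := O.nonempty_edge
  have hpow (i : ℕ) : col (O.first ((O.next ^ i) e)) = col (O.first e) + Fin.ofNat 2 i := by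
    induction i with
    | zero => simp
    | succ i ih =>
      rw [pow_succ', Equiv.Perm.mul_apply, hstep, ih]
      generalize col (O.first e) = a
      ext
      simp [Fin.val_add, Nat.add_assoc]
  have h1 := hpow (Fintype.card E)
  rw [O.pow_card_next, left_eq_add] at h1
  simpa [Fin.ext_iff, Nat.even_iff] using h1

/-- The length of the first `i` edges that are visited when starting with the edge `e`. -/
noncomputable def arc (e : E) (i : ℕ) : ℝ := ∑ j ∈ Finset.range i, Γ.len ((O.next ^ j) e)

theorem arc_card [Fintype E] (e : E) : O.arc e (Fintype.card E) = ∑ e, Γ.len e := by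
  refine Finset.sum_bij (fun j _ => (O.next ^ j) e) (fun _ _ => Finset.mem_univ _) ?_ ?_
    (fun _ _ => rfl)
  · intro i hi j hj h
    exact O.pow_next_injOn e (Finset.mem_range.1 hi) (Finset.mem_range.1 hj) h
  · intro e' _
    obtain ⟨i, hi, h⟩ := O.exists_pow_next_eq e e'
    exact ⟨i, Finset.mem_range.2 hi, h⟩

/-- Families of Cauchy data at the starting points of the edges, such that the solutions of
`y'' = -c y` with these data change sign in passing from every edge to the next one. -/
noncomputable def cauchyData (c : ℝ) : Submodule ℝ (E → ℝ × ℝ) where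
  carrier := {d | ∀ e, d (O.next e) = -oscFlow c (Γ.len e) (d e)}
  zero_mem' e := by simp
  add_mem' {d d'} hd hd' e := by
    rw [Pi.add_apply, Pi.add_apply, hd e, hd' e, map_add, neg_add]
  smul_mem' r d hd e := by
    rw [Pi.smul_apply, Pi.smul_apply, hd e, map_smul, smul_neg]

theorem cauchyData_pow {c : ℝ} {d : E → ℝ × ℝ} (hd : d ∈ O.cauchyData c) (e : E) (i : ℕ) :
    d ((O.next ^ i) e) = (-1 : ℝ) ^ i • oscFlow c (O.arc e i) (d e) := by
  induction i with
  | zero => simp [arc, oscFlow_zero]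
  | succ i ih =>
    rw [pow_succ', Equiv.Perm.mul_apply, hd, ih, map_smul, ← oscFlow_add, arc, arc,
      Finset.sum_range_succ, add_comm, pow_succ]
    simp

/-- Going once around the circle, the Cauchy data on one edge are transported by the flow over the
total length, with one change of sign for every edge. -/
theorem finrank_cauchyData (O : Γ.CircularOrientation) [Fintype E] (c : ℝ) :
    Module.finrank ℝ (O.cauchyData c) =
      Module.finrank ℝ (monodromyKer c (∑ e, Γ.len e) ((-1) ^ Fintype.card E)) := by
  obtain ⟨e⟩ := O.nonempty_edge
  have hcard : 0 < Fintype.card E := Fintype.card_pos_iff.2 ⟨e⟩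
  have hsq : ((-1 : ℝ) ^ Fintype.card E) * ((-1 : ℝ) ^ Fintype.card E) = 1 := by
    rw [← mul_pow]; norm_num
  let ev : O.cauchyData c →ₗ[ℝ] ℝ × ℝ := (LinearMap.proj e).comp (O.cauchyData c).subtype
  have hinj : Function.Injective ev := by
    refine (injective_iff_map_eq_zero _).2 fun d hd => Subtype.ext (funext fun e' => ?_)
    obtain ⟨i, -, rfl⟩ := O.exists_pow_next_eq e e'
    have h0 : (d : E → ℝ × ℝ) e = 0 := hd
    rw [O.cauchyData_pow d.2, h0, map_zero, smul_zero]
    rfl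
  have hrange : LinearMap.range ev = monodromyKer c (∑ e, Γ.len e) ((-1) ^ Fintype.card E) := by
    ext v
    rw [LinearMap.mem_range, mem_monodromyKer]
    constructor
    · rintro ⟨d, rfl⟩
      have h := O.cauchyData_pow d.2 e (Fintype.card E)
      rw [O.pow_card_next, O.arc_card] at h
      change oscFlow c _ ((d : E → ℝ × ℝ) e) = (-1 : ℝ) ^ Fintype.card E • (d : E → ℝ × ℝ) e
      conv_rhs => rw [h]
      rw [smul_smul, hsq, one_smul]
    · intro hv
      choose pos hpos_lt hpos using O.exists_pow_next_eq e
      refine ⟨⟨fun e' => (-1 : ℝ) ^ pos e' • oscFlow c (O.arc e (pos e')) v, fun e' => ?_⟩, ?_⟩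
      · have hstep : -oscFlow c (Γ.len e') ((-1 : ℝ) ^ pos e' • oscFlow c (O.arc e (pos e')) v) =
            (-1 : ℝ) ^ (pos e' + 1) • oscFlow c (O.arc e (pos e' + 1)) v := by
          rw [map_smul, ← oscFlow_add, arc, arc, Finset.sum_range_succ, hpos, add_comm, pow_succ]
          simp
        rw [hstep]
        dsimp only
        have hnext : (O.next ^ pos (O.next e')) e = (O.next ^ (pos e' + 1)) e := by
          rw [hpos, pow_succ', Equiv.Perm.mul_apply, hpos]
        rcases Nat.lt_or_ge (pos e' + 1) (Fintype.card E) with hlt | hge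
        · rw [O.pow_next_injOn e (hpos_lt _) hlt hnext]
        -- On the last edge the circle closes up, which is where the condition on `v` enters.
        · have hlast : pos e' + 1 = Fintype.card E := le_antisymm (hpos_lt e') hge
          rw [hlast] at hnext ⊢
          rw [O.pow_card_next] at hnext
          rw [O.pow_next_injOn e (hpos_lt _) hcard hnext, O.arc_card, hv, smul_smul, hsq]
          simp [arc, oscFlow_zero]
      · have h0 : pos e = 0 := O.pow_next_injOn e (hpos_lt e) hcard (hpos e)
        simp [ev, h0, arc, oscFlow_zero]
  rw [← hrange, LinearMap.finrank_range_of_inj hinj]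

end CircularOrientation

open scoped Classical in
/-- Going around an odd cycle provides a circular orientation. -/
theorem IsOddCycle.exists_circularOrientation [Fintype V] {Γ : MetricGraph V E}
    (h : Γ.IsOddCycle) : Nonempty Γ.CircularOrientation ∧ Odd (Fintype.card V) := by
  obtain ⟨n, hn, hodd, ⟨φ⟩⟩ := h
  have hcardV : Fintype.card V = n := by simpa using Fintype.card_congr φ.toEquiv
  refine ⟨?_, hcardV ▸ hodd⟩
  obtain ⟨m, rfl⟩ : ∃ m, n = m + 1 + 2 := ⟨n - 3, by omega⟩
  have hadj (e : E) : φ (Γ.src e) - φ (Γ.tgt e) = 1 ∨ φ (Γ.tgt e) - φ (Γ.src e) = 1 := by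
    rw [← SimpleGraph.cycleGraph_adj, φ.map_adj_iff, graph, SimpleGraph.fromEdgeSet_adj]
    exact ⟨⟨e, rfl⟩, Γ.src_ne_tgt e⟩
  set first : E → V := fun e => if φ (Γ.tgt e) - φ (Γ.src e) = 1 then Γ.src e else Γ.tgt e
    with hfirst
  set second : E → V := fun e => if φ (Γ.tgt e) - φ (Γ.src e) = 1 then Γ.tgt e else Γ.src e
    with hsecond
  have hends (e : E) : (first e = Γ.src e ∧ second e = Γ.tgt e) ∨
      (first e = Γ.tgt e ∧ second e = Γ.src e) := by
    by_cases h : φ (Γ.tgt e) - φ (Γ.src e) = 1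
    · left; simp [hfirst, hsecond, h]
    · right; simp [hfirst, hsecond, h]
  have hmk (e : E) : s(first e, second e) = s(Γ.src e, Γ.tgt e) := by
    rcases hends e with ⟨h1, h2⟩ | ⟨h1, h2⟩ <;> rw [h1, h2]
    exact Sym2.eq_swap
  have hsucc (e : E) : φ (second e) = φ (first e) + 1 := by
    by_cases h : φ (Γ.tgt e) - φ (Γ.src e) = 1
    · rw [show second e = Γ.tgt e from if_pos h, show first e = Γ.src e from if_pos h, ← h]
      abel
    · rw [show second e = Γ.src e from if_neg h, show first e = Γ.tgt e from if_neg h,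
        ← (hadj e).resolve_right h]
      abel
  have hinj : Function.Injective first := by
    intro e e' he
    have he2 : second e = second e' := φ.injective (by rw [hsucc, hsucc, he])
    exact Γ.simple (((hmk e).symm.trans (by rw [he, he2])).trans (hmk e'))
  have hsurj : Function.Surjective first := by
    intro v
    have hv : Γ.graph.Adj v (φ.symm (φ v + 1)) := by
      rw [← φ.map_adj_iff, SimpleGraph.cycleGraph_adj]
      right
      simp
    obtain ⟨⟨e, he⟩, -⟩ := (SimpleGraph.fromEdgeSet_adj _).1 hv
    replace he := (hmk e).trans he
    refine ⟨e, ?_⟩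
    rcases Sym2.eq_iff.1 he with ⟨h1, -⟩ | ⟨h1, h2⟩
    · exact h1
    -- Otherwise `1 + 1 = 0` in `Fin n`, which fails as `n ≥ 3`.
    · exfalso
      have h3 := hsucc e
      rw [h1, h2] at h3
      have h4 : φ v + 0 = φ v + (1 + 1) := by simpa [add_assoc] using h3
      have h5 := congrArg Fin.val (add_left_cancel h4)
      simp [Fin.val_add] at h5
      rw [Nat.mod_eq_of_lt (by omega)] at h5
      omega
  have hsecond' : second = φ.symm ∘ (fun i => i + 1) ∘ φ ∘ first := by
    funext e
    simp [← hsucc]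
  refine ⟨⟨first, second, hends, ⟨hinj, hsurj⟩, ?_⟩⟩
  rw [hsecond']
  exact φ.symm.bijective.comp ((Equiv.addRight 1).bijective.comp
    (φ.bijective.comp ⟨hinj, hsurj⟩))

/-! ### Inserting vertices preserves circular orientations -/

section Insertion

variable {Γ : MetricGraph V E}

theorem Insertion.node_zero (S : Γ.Insertion) (e : E) : S.node e 0 = Sum.inl (Γ.src e) := by
  simp [Insertion.node]

theorem Insertion.node_last (S : Γ.Insertion) (e : E) :
    S.node e (S.num e + 1) = Sum.inl (Γ.tgt e) := by
  simp [Insertion.node]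

theorem Insertion.node_succ (S : Γ.Insertion) (e : E) (k : Fin (S.num e)) :
    S.node e (k + 1) = Sum.inr ⟨e, k⟩ := by
  simp [Insertion.node]

open scoped Classical in
/-- The starting point of a piece of a subdivided edge, in the direction that `O` gives to that
edge. -/
noncomputable def CircularOrientation.insertFirst (O : Γ.CircularOrientation) (S : Γ.Insertion)
    (a : Σ e, Fin (S.num e + 1)) : V ⊕ (Σ e, Fin (S.num e)) :=
  if O.first a.1 = Γ.src a.1 then S.node a.1 a.2 else S.node a.1 (a.2 + 1)

theorem CircularOrientation.insertFirst_bijective [Fintype V] [Fintype E]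
    (O : Γ.CircularOrientation) (S : Γ.Insertion) : Function.Bijective (O.insertFirst S) := by
  rw [Fintype.bijective_iff_surjective_and_card]
  constructor
  · rintro (v | ⟨e, k⟩)
    · obtain ⟨e, rfl⟩ := O.first_bijective.2 v
      by_cases h : O.first e = Γ.src e
      · exact ⟨⟨e, 0⟩, by simp [insertFirst, h, S.node_zero]⟩
      · refine ⟨⟨e, Fin.last _⟩, ?_⟩
        simp [insertFirst, S.node_last, (O.eq_of_first_ne e h).1, (Γ.src_ne_tgt e).symm]
    · by_cases h : O.first e = Γ.src e
      · exact ⟨⟨e, k.succ⟩, by simp [insertFirst, h, S.node_succ]⟩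
      · exact ⟨⟨e, k.castSucc⟩, by simp [insertFirst, h, S.node_succ]⟩
  · simp [Finset.sum_add_distrib, O.card_eq, add_comm]

/-- The circular orientation of the subdivided graph. -/
noncomputable def CircularOrientation.insert [Fintype V] [Fintype E] (O : Γ.CircularOrientation)
    (S : Γ.Insertion) : (insertVertices S).CircularOrientation where
  first := O.insertFirst S
  second := O.reverse.insertFirst S
  ends a := by
    by_cases h : O.first a.1 = Γ.src a.1
    · left
      have : O.second a.1 ≠ Γ.src a.1 := by
        rw [O.second_eq _ h]
        exact (Γ.src_ne_tgt _).symm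
      simp [insertFirst, reverse, insertVertices, h, this]
    · right
      simp [insertFirst, reverse, insertVertices, h, (O.eq_of_first_ne _ h).2]
  first_bijective := O.insertFirst_bijective S
  second_bijective := O.reverse.insertFirst_bijective S

theorem sum_len_insertVertices [Fintype E] (S : Γ.Insertion) :
    ∑ a, (insertVertices S).len a = ∑ e, Γ.len e := by
  rw [Fintype.sum_sigma]
  refine Finset.sum_congr rfl fun e _ => ?_
  change ∑ i : Fin (S.num e + 1), (S.pos e (i + 1) - S.pos e i) = _
  rw [Fin.sum_univ_eq_sum_range (fun i => S.pos e (i + 1) - S.pos e i), Finset.sum_range_sub,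
    S.pos_last, S.pos_zero, sub_zero]

end Insertion

/-! ### The eigenspaces -/

theorem mem_eigenspaceOf_antiStandardLaplacian [Fintype E] (Γ : MetricGraph V E) (c : ℝ)
    (f : Γ.L2) : f ∈ eigenspaceOf Γ.antiStandardLaplacian c ↔
      ∃ u u', Γ.IsRegularRep f u u' ∧ Γ.AntiStandard u u' ∧
        ∀ e, ∀ᵐ x ∂volume.restrict (Icc 0 (Γ.len e)), c * u e x = -deriv (u' e) x := by
  have hgraph (g : Γ.L2) : (f, g) ∈ Γ.antiStandardLaplacian.graph ↔
      f ∈ Γ.antiStandardSpace ∧ (f, g) ∈ Γ.maxGraph := by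
    rw [← maxLaplacian_graph, LinearPMap.mem_graph_iff, LinearPMap.mem_graph_iff]
    constructor
    · rintro ⟨y, hy, hyg⟩
      dsimp only at hy hyg
      subst hy
      refine ⟨y.2.1, ⟨⟨y, y.2.2⟩, rfl, ?_⟩⟩
      rw [← hyg]
      exact (LinearPMap.domRestrict_apply rfl).symm
    · rintro ⟨hf, y, hy, hyg⟩
      dsimp only at hy hyg
      subst hy
      refine ⟨⟨y, hf, y.2⟩, rfl, ?_⟩
      rw [← hyg]
      exact LinearPMap.domRestrict_apply rfl
  have hsmul (e : E) : (((c • f : Γ.L2) e : Lp ℝ 2 _) : ℝ → ℝ)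
      =ᵐ[volume.restrict (Icc 0 (Γ.len e))] fun x => c * (f e : ℝ → ℝ) x :=
    Lp.coeFn_smul c (f e)
  change (f, c • f) ∈ Γ.antiStandardLaplacian.graph ↔ _
  rw [hgraph]
  constructor
  · rintro ⟨⟨v, v', hv, hbc⟩, u, u', hu, hg⟩
    refine ⟨u, u', hu, ?_, fun e => ?_⟩
    · have hend (w : V) (e : E) : Γ.endValue u w e = Γ.endValue v w e := by
        have h := (hu.unique hv e).1
        have hl := (Γ.len_pos e).le
        unfold endValue
        rw [h ⟨le_rfl, hl⟩, h ⟨hl, le_rfl⟩]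
      have hout (w : V) (e : E) : Γ.outDeriv u' w e = Γ.outDeriv v' w e := by
        have h := (hu.unique hv e).2
        have hl := (Γ.len_pos e).le
        unfold outDeriv
        rw [h ⟨le_rfl, hl⟩, h ⟨hl, le_rfl⟩]
      refine ⟨fun w e e' he he' => ?_, fun w => ?_⟩
      · rw [hout, hout, hbc.deriv_eq w e e' he he']
      · simp only [hend, hbc.sum_eq_zero w]
    · filter_upwards [hg e, hsmul e, hu.ae_eq e] with x h1 h2 h3
      rw [← h1, h2, h3]
  · rintro ⟨u, u', hu, hbc, h⟩
    refine ⟨⟨u, u', hu, hbc⟩, u, u', hu, fun e => ?_⟩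
    filter_upwards [h e, hsmul e, hu.ae_eq e] with x h1 h2 h3
    rw [h2, h3, h1]

namespace CircularOrientation

variable {Γ : MetricGraph V E} (O : Γ.CircularOrientation)

open scoped Classical in
/-- The change between the given coordinate on the edge `e` and the distance from the point
`O.first e`; it is its own inverse. -/
noncomputable def coord (e : E) (x : ℝ) : ℝ := if O.first e = Γ.src e then x else Γ.len e - x

open scoped Classical in
/-- `1` or `-1`, according to whether the direction of `e` is that of its parametrisation. -/
noncomputable def sgn (e : E) : ℝ := if O.first e = Γ.src e then 1 else -1

theorem coord_coord (e : E) (x : ℝ) : O.coord e (O.coord e x) = x := by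
  unfold coord; split_ifs <;> ring

theorem coord_mem {e : E} {x : ℝ} (hx : x ∈ Icc 0 (Γ.len e)) :
    O.coord e x ∈ Icc 0 (Γ.len e) := by
  unfold coord
  split_ifs
  · exact hx
  · exact ⟨by linarith [hx.2], by linarith [hx.1]⟩

theorem sgn_mul_sgn (e : E) : O.sgn e * O.sgn e = 1 := by
  unfold sgn; split_ifs <;> norm_num

theorem hasDerivAt_coord (e : E) (x : ℝ) : HasDerivAt (O.coord e) (O.sgn e) x := by
  by_cases h : O.first e = Γ.src e
  · rw [show O.coord e = fun x => x from funext fun x => if_pos h, sgn, if_pos h]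
    exact hasDerivAt_id' x
  · rw [show O.coord e = fun x => Γ.len e - x from funext fun x => if_neg h, sgn, if_neg h]
    exact (hasDerivAt_id' x).const_sub _

theorem contDiff_coord (e : E) : ContDiff ℝ 1 (O.coord e) := by
  unfold coord
  split_ifs <;> fun_prop

theorem endValue_first (u : E → ℝ → ℝ) (e : E) :
    Γ.endValue u (O.first e) e = u e (O.coord e 0) := by
  by_cases h : O.first e = Γ.src e
  · rw [endValue, if_pos h.symm, coord, if_pos h]
  · rw [endValue, if_neg (Ne.symm h), coord, if_neg h, sub_zero]

theorem endValue_second (u : E → ℝ → ℝ) (e : E) :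
    Γ.endValue u (O.second e) e = u e (O.coord e (Γ.len e)) := by
  by_cases h : O.first e = Γ.src e
  · rw [endValue, if_neg (by rw [← h]; exact O.first_ne_second e), coord, if_pos h]
  · rw [endValue, if_pos (O.eq_of_first_ne e h).2.symm, coord, if_neg h, sub_self]

theorem outDeriv_first (u' : E → ℝ → ℝ) (e : E) :
    Γ.outDeriv u' (O.first e) e = O.sgn e * u' e (O.coord e 0) := by
  by_cases h : O.first e = Γ.src e
  · rw [outDeriv, if_pos h.symm, coord, sgn, if_pos h, if_pos h, one_mul]
  · rw [outDeriv, if_neg (Ne.symm h), coord, sgn, if_neg h, if_neg h, sub_zero, neg_one_mul]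

theorem outDeriv_second (u' : E → ℝ → ℝ) (e : E) :
    Γ.outDeriv u' (O.second e) e = -(O.sgn e * u' e (O.coord e (Γ.len e))) := by
  by_cases h : O.first e = Γ.src e
  · rw [outDeriv, if_neg (by rw [← h]; exact O.first_ne_second e), coord, sgn, if_pos h, if_pos h,
      one_mul]
  · rw [outDeriv, if_pos (O.eq_of_first_ne e h).2.symm, coord, sgn, if_neg h, if_neg h, sub_self,
      neg_one_mul, neg_neg]

/-- At a vertex of degree two the anti-standard conditions say that value and derivative, taken in
the direction of the circle, both change sign. -/
theorem antiStandard_iff [Fintype E] (u u' : E → ℝ → ℝ) : Γ.AntiStandard u u' ↔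
    ∀ e, u (O.next e) (O.coord (O.next e) 0) = -u e (O.coord e (Γ.len e)) ∧
      O.sgn (O.next e) * u' (O.next e) (O.coord (O.next e) 0) =
        -(O.sgn e * u' e (O.coord e (Γ.len e))) := by
  classical
  have hsum (e : E) : ∑ e' with Γ.Incident (O.second e) e', Γ.endValue u (O.second e) e' =
      u e (O.coord e (Γ.len e)) + u (O.next e) (O.coord (O.next e) 0) := by
    have : (Finset.univ.filter fun e' => Γ.Incident (O.second e) e') = {e, O.next e} := by
      ext e'
      simp [O.incident_second_iff]
    rw [this, Finset.sum_pair (O.next_ne e).symm, O.endValue_second, ← O.first_next,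
      O.endValue_first]
  have hnext (e : E) : Γ.outDeriv u' (O.second e) (O.next e) =
      O.sgn (O.next e) * u' (O.next e) (O.coord (O.next e) 0) := by
    rw [← O.first_next, O.outDeriv_first]
  constructor
  · rintro ⟨h1, h2⟩ e
    have h3 := h1 (O.second e) (O.next e) e (O.incident_second_iff.2 (Or.inr rfl))
      (O.incident_second_iff.2 (Or.inl rfl))
    have h4 := h2 (O.second e)
    rw [hnext, O.outDeriv_second] at h3
    refine ⟨?_, h3⟩
    have h5 := (hsum e).symm.trans (by convert h4)
    linarith
  · intro h
    refine ⟨fun w e₁ e₂ h1 h2 => ?_, fun w => ?_⟩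
    · obtain ⟨e, rfl⟩ := O.second_bijective.2 w
      have key (e' : E) (he' : Γ.Incident (O.second e) e') :
          Γ.outDeriv u' (O.second e) e' = -(O.sgn e * u' e (O.coord e (Γ.len e))) := by
        rcases O.incident_second_iff.1 he' with rfl | rfl
        · exact O.outDeriv_second u' e'
        · rw [hnext, (h e).2]
      rw [key e₁ h1, key e₂ h2]
    · obtain ⟨e, rfl⟩ := O.second_bijective.2 w
      have h5 := hsum e
      rw [(h e).1, add_neg_cancel] at h5
      convert h5

/-- On every edge the solution of `y'' = -c y` with the Cauchy data `d e` at `O.first e`. -/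
noncomputable def edgeSol (c : ℝ) (d : E → ℝ × ℝ) (e : E) (x : ℝ) : ℝ :=
  (oscFlow c (O.coord e x) (d e)).1

/-- The derivative of `edgeSol`. -/
noncomputable def edgeSolDeriv (c : ℝ) (d : E → ℝ × ℝ) (e : E) (x : ℝ) : ℝ :=
  O.sgn e * (oscFlow c (O.coord e x) (d e)).2

theorem hasDerivAt_edgeSol (c : ℝ) (d : E → ℝ × ℝ) (e : E) (x : ℝ) :
    HasDerivAt (O.edgeSol c d e) (O.edgeSolDeriv c d e x) x := by
  have := (hasDerivAt_oscFlow_fst c (O.coord e x) (d e)).comp x (O.hasDerivAt_coord e x)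
  rwa [mul_comm] at this

theorem hasDerivAt_edgeSolDeriv (c : ℝ) (d : E → ℝ × ℝ) (e : E) (x : ℝ) :
    HasDerivAt (O.edgeSolDeriv c d e) (-(c * O.edgeSol c d e x)) x := by
  convert! ((hasDerivAt_oscFlow_snd c (O.coord e x) (d e)).comp x
    (O.hasDerivAt_coord e x)).const_mul (O.sgn e) using 1
  rw [edgeSol]
  linear_combination c * (oscFlow c (O.coord e x) (d e)).1 * O.sgn_mul_sgn e

theorem contDiff_edgeSol (c : ℝ) (d : E → ℝ × ℝ) (e : E) : ContDiff ℝ 1 (O.edgeSol c d e) :=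
  (contDiff_oscFlow_fst c (d e)).comp (O.contDiff_coord e)

theorem contDiff_edgeSolDeriv (c : ℝ) (d : E → ℝ × ℝ) (e : E) :
    ContDiff ℝ 1 (O.edgeSolDeriv c d e) :=
  contDiff_const.mul ((contDiff_oscFlow_snd c (d e)).comp (O.contDiff_coord e))

theorem memLp_edgeSol (c : ℝ) (d : E → ℝ × ℝ) (e : E) :
    MemLp (O.edgeSol c d e) 2 (volume.restrict (Icc 0 (Γ.len e))) := by
  have hcont := (O.contDiff_edgeSol c d e).continuous
  obtain ⟨C, hC⟩ := isCompact_Icc.exists_bound_of_continuousOn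
    (hcont.continuousOn (s := Icc 0 (Γ.len e)))
  refine MemLp.of_bound hcont.aestronglyMeasurable C ?_
  filter_upwards [ae_restrict_mem measurableSet_Icc] with x hx using hC x hx

/-- The element of `L²` given by `edgeSol`, as a linear function of the Cauchy data. -/
noncomputable def edgeSolL2 [Fintype E] (c : ℝ) : (E → ℝ × ℝ) →ₗ[ℝ] Γ.L2 where
  toFun d := WithLp.toLp 2 fun e => (O.memLp_edgeSol c d e).toLp
  map_add' d d' := by
    ext1 e
    rw [PiLp.add_apply]
    refine Eq.trans ?_ (MemLp.toLp_add (O.memLp_edgeSol c d e) (O.memLp_edgeSol c d' e))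
    refine (MemLp.toLp_eq_toLp_iff (O.memLp_edgeSol c (d + d') e) _).2
      (Filter.Eventually.of_forall fun x => ?_)
    simp [edgeSol]
  map_smul' r d := by
    ext1 e
    rw [PiLp.smul_apply]
    refine Eq.trans ?_ (MemLp.toLp_const_smul r (O.memLp_edgeSol c d e))
    refine (MemLp.toLp_eq_toLp_iff (O.memLp_edgeSol c (r • d) e) _).2
      (Filter.Eventually.of_forall fun x => ?_)
    simp [edgeSol]

theorem isRegularRep_edgeSolL2 [Fintype E] (c : ℝ) (d : E → ℝ × ℝ) :
    Γ.IsRegularRep (O.edgeSolL2 c d) (O.edgeSol c d) (O.edgeSolDeriv c d) where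
  ae_eq e := MemLp.coeFn_toLp (O.memLp_edgeSol c d e)
  ac e := (O.contDiff_edgeSol c d e).contDiffOn.absolutelyContinuousOnInterval
  hasDeriv e x _ := (O.hasDerivAt_edgeSol c d e x).hasDerivWithinAt
  ac_deriv e := (O.contDiff_edgeSolDeriv c d e).contDiffOn.absolutelyContinuousOnInterval

theorem edgeSol_coord (c : ℝ) (d : E → ℝ × ℝ) (e : E) (x : ℝ) :
    O.edgeSol c d e (O.coord e x) = (oscFlow c x (d e)).1 := by
  rw [edgeSol, coord_coord]

theorem sgn_mul_edgeSolDeriv_coord (c : ℝ) (d : E → ℝ × ℝ) (e : E) (x : ℝ) :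
    O.sgn e * O.edgeSolDeriv c d e (O.coord e x) = (oscFlow c x (d e)).2 := by
  rw [edgeSolDeriv, coord_coord, ← mul_assoc, sgn_mul_sgn, one_mul]

theorem antiStandard_edgeSol_iff [Fintype E] (c : ℝ) (d : E → ℝ × ℝ) :
    Γ.AntiStandard (O.edgeSol c d) (O.edgeSolDeriv c d) ↔ d ∈ O.cauchyData c := by
  rw [O.antiStandard_iff]
  simp only [edgeSol_coord, sgn_mul_edgeSolDeriv_coord, oscFlow_zero]
  exact forall_congr' fun e =>
    (Prod.ext_iff (x := d (O.next e)) (y := -oscFlow c (Γ.len e) (d e))).symm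

theorem edgeSolL2_injective [Fintype E] (c : ℝ) : Function.Injective (O.edgeSolL2 c) := by
  refine (injective_iff_map_eq_zero _).2 fun d hd => funext fun e => ?_
  have h := O.isRegularRep_edgeSolL2 c d
  rw [hd] at h
  obtain ⟨h1, h2⟩ := h.unique Γ.isRegularRep_zero e
  have h0 : O.coord e 0 ∈ Icc 0 (Γ.len e) := O.coord_mem ⟨le_rfl, (Γ.len_pos e).le⟩
  ext
  · simpa [edgeSol_coord, oscFlow_zero] using h1 h0
  · have := congrArg (O.sgn e * ·) (h2 h0)
    simpa [sgn_mul_edgeSolDeriv_coord, oscFlow_zero] using this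

/-- A regular solution of `-f'' = c f` on an edge is determined by its Cauchy data at the starting
point of the edge. -/
theorem eq_edgeSol [Fintype E] {c : ℝ} {f : Γ.L2} {u u' : E → ℝ → ℝ}
    (hu : Γ.IsRegularRep f u u') {e : E}
    (h : ∀ᵐ x ∂volume.restrict (Icc 0 (Γ.len e)), c * u e x = -deriv (u' e) x) {x : ℝ}
    (hx : x ∈ Icc 0 (Γ.len e)) :
    (u e x, O.sgn e * u' e x) =
      oscFlow c (O.coord e x) (u e (O.coord e 0), O.sgn e * u' e (O.coord e 0)) := by
  have hl := (Γ.len_pos e).le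
  have h1 : ∀ᵐ x, x ∈ Icc 0 (Γ.len e) → HasDerivAt (u e) (u' e x) x := by
    rw [← ae_restrict_iff' measurableSet_Icc, ← Measure.restrict_congr_set
      (Ioo_ae_eq_Icc (μ := volume))]
    filter_upwards [ae_restrict_mem measurableSet_Ioo] with y hy
    exact (hu.hasDeriv e y (Ioo_subset_Icc_self hy)).hasDerivAt (Icc_mem_nhds hy.1 hy.2)
  have h2 : ∀ᵐ x, x ∈ Icc 0 (Γ.len e) → HasDerivAt (u' e) (-(c * u e x)) x := by
    filter_upwards [(ae_restrict_iff' measurableSet_Icc).1 h, (hu.ac_deriv e).ae_differentiableAt]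
      with y hy hd hmem
    rw [hy hmem, neg_neg]
    exact (hd (by rwa [uIcc_of_le hl])).hasDerivAt
  have key := eq_oscFlow_of_ae hl (hu.ac e) (hu.ac_deriv e) h1 h2
  by_cases hdir : O.first e = Γ.src e
  · simp only [coord, sgn, if_pos hdir, one_mul]
    exact key x hx
  · have k1 := key x hx
    have k2 := key (Γ.len e) ⟨hl, le_rfl⟩
    simp only [coord, sgn, if_neg hdir, neg_one_mul, sub_zero]
    have hrev := oscFlow_neg c (x - Γ.len e) (u e (Γ.len e), u' e (Γ.len e))
    rw [neg_sub] at hrev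
    rw [hrev, k2, ← oscFlow_add, sub_add_cancel, ← k1]

theorem eigenspaceOf_eq_map [Fintype E] (c : ℝ) :
    eigenspaceOf Γ.antiStandardLaplacian c = (O.cauchyData c).map (O.edgeSolL2 c) := by
  ext f
  rw [mem_eigenspaceOf_antiStandardLaplacian, Submodule.mem_map]
  constructor
  · rintro ⟨u, u', hu, hbc, h⟩
    set d : E → ℝ × ℝ := fun e => (u e (O.coord e 0), O.sgn e * u' e (O.coord e 0)) with hd
    have key (e : E) (x : ℝ) (hx : x ∈ Icc 0 (Γ.len e)) := O.eq_edgeSol hu (h e) hx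
    refine ⟨d, fun e => ?_, ?_⟩
    · have h1 := key e (O.coord e (Γ.len e)) (O.coord_mem ⟨(Γ.len_pos e).le, le_rfl⟩)
      rw [coord_coord] at h1
      have h2 := (O.antiStandard_iff u u').1 hbc e
      rw [hd, ← h1]
      exact Prod.ext h2.1 h2.2
    · ext1 e
      refine Lp.ext ((MemLp.coeFn_toLp (O.memLp_edgeSol c d e)).trans
        (Filter.EventuallyEq.trans ?_ (hu.ae_eq e).symm))
      filter_upwards [ae_restrict_mem measurableSet_Icc] with x hx
      exact (congrArg Prod.fst (key e x hx)).symm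
  · rintro ⟨d, hd, rfl⟩
    refine ⟨_, _, O.isRegularRep_edgeSolL2 c d, (O.antiStandard_edgeSol_iff c d).2 hd, fun e => ?_⟩
    refine Filter.Eventually.of_forall fun x => ?_
    rw [(O.hasDerivAt_edgeSolDeriv c d e x).deriv, neg_neg]

theorem finiteDimensional_eigenspaceOf (O : Γ.CircularOrientation) [Fintype E] (c : ℝ) :
    FiniteDimensional ℝ (eigenspaceOf Γ.antiStandardLaplacian c) := by
  rw [O.eigenspaceOf_eq_map c]
  infer_instance

theorem finrank_eigenspaceOf (O : Γ.CircularOrientation) [Fintype E] (c : ℝ) :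
    Module.finrank ℝ (eigenspaceOf Γ.antiStandardLaplacian c) =
      Module.finrank ℝ (monodromyKer c (∑ e, Γ.len e) ((-1) ^ Fintype.card E)) := by
  rw [O.eigenspaceOf_eq_map c, ← O.finrank_cauchyData c]
  exact ((O.cauchyData c).equivMapOfInjective _ (O.edgeSolL2_injective c)).finrank_eq.symm

theorem sum_len_pos (O : Γ.CircularOrientation) [Fintype E] : 0 < ∑ e, Γ.len e := by
  have := O.nonempty_edge
  exact Finset.sum_pos (fun e _ => Γ.len_pos e) Finset.univ_nonempty

theorem isEigenvalueList_of_odd (O : Γ.CircularOrientation) [Fintype E]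
    (h : Odd (Fintype.card E)) :
    IsEigenvalueList Γ.antiStandardLaplacian (antiperiodicEigenvalue (∑ e, Γ.len e)) :=
  isEigenvalueList_antiperiodic O.sum_len_pos O.finiteDimensional_eigenspaceOf fun c => by
    rw [O.finrank_eigenspaceOf, h.neg_one_pow]

theorem isEigenvalueList_of_even (O : Γ.CircularOrientation) [Fintype E]
    (h : Even (Fintype.card E)) :
    IsEigenvalueList Γ.antiStandardLaplacian (periodicEigenvalue (∑ e, Γ.len e)) :=
  isEigenvalueList_periodic O.sum_len_pos O.finiteDimensional_eigenspaceOf fun c => by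
    rw [O.finrank_eigenspaceOf, h.neg_one_pow]

end CircularOrientation

end MetricGraph

/-! ### The comparison of the two spectra -/

theorem corollary4p1 {V E : Type*} [Fintype V] [Fintype E] (Γ : MetricGraph V E)
    (hcycle : Γ.IsOddCycle) (hequi : Γ.IsEquilateral)
    (S : Γ.Insertion)
    (hequi' : (MetricGraph.insertVertices S).IsEquilateral)
    (hbip : (MetricGraph.insertVertices S).graph.IsBipartite)
    (μ : ℕ → ℝ) (hμ : Γ.IsTransitionSpectrum μ)
    (h_upper : ∀ i j : ℕ, 2 ≤ i → 2 ≤ j → i + j = Fintype.card V + 2 → μ i ≤ -μ j)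
    (h_lower : ∀ i j : ℕ, 2 ≤ i → 2 ≤ j → i + j = Fintype.card V → μ i ≥ -μ j) :
    (∃ lam, IsEigenvalueList Γ.antiStandardLaplacian lam) ∧
    (∃ lam', IsEigenvalueList (MetricGraph.insertVertices S).antiStandardLaplacian lam') ∧
    ∀ lam lam' : ℕ → ℝ, IsEigenvalueList Γ.antiStandardLaplacian lam →
      IsEigenvalueList (MetricGraph.insertVertices S).antiStandardLaplacian lam' →
      ∀ k : ℕ, lam' (k + 1) ≥ lam k := by
  obtain ⟨⟨O⟩, hodd⟩ := hcycle.exists_circularOrientation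
  have hΓ := O.isEigenvalueList_of_odd (O.card_eq ▸ hodd)
  have hS := (O.insert S).isEigenvalueList_of_even
    ((O.insert S).even_card_of_isBipartite hbip)
  rw [MetricGraph.sum_len_insertVertices] at hS
  refine ⟨⟨_, hΓ⟩, ⟨_, hS⟩, fun lam lam' hlam hlam' k => ?_⟩
  rw [hlam.unique hΓ, hlam'.unique hS]
  exact antiperiodicEigenvalue_le_periodicEigenvalue O.sum_len_pos k
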